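/- There exist a bounded domain (nonempty connected open set) $\Omega\subset\mathbb C^2$ and a closed set $E\subset\partial\Omega$ such that: - $\Omega$ is not pseudoconvex, i.e. there is no continuous plurisubharmonic function $u:\Omega\to\mathbb R$ such that $\{z\in\Omega: u(z)<c\}$ is relatively compact in $\Omega$ for every $c\in\mathbb R$; - $\partial\Omega$ is $\mathcal C^{1,1}$-smooth, i.e. there is a continuous $\rho:\mathbb C^2\to\mathbb R$ with $\Omega=\{\rho<0\}$ and $\partial\Omega=\{\rho=0\}$, and an open neighborhood $V$ of $\partial\Omega$ on which $\rho$ is $\mathcal C^1$ with Lipschitz gradient and $|\nabla\rho|\ge c_0$ for some constant $c_0>0$; - $\partial\Omega\setminus E$ is dense in $\partial\Omega$; - $\partial\Omega$ is $\mathcal C^2$-smooth and strictly pseudoconvex in a neighborhood of each point of $\partial\Omega\setminus E$, i.e. every $p\in\partial\Omega\setminus E$ has an open neighborhood $U$ with a $\mathcal C^2$ function $\rho:U\to\mathbb R$ such that $\Omega\cap U=\{z \in U:\rho(z)<0\}$, $\partial\Omega\cap U=\{z\in U:\rho(z)=0\}$, and, at every $q\in\partial\Omega\cap U$, $d\rho(q)\neq0$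 and $$\sum_{j,k=1}^2\frac{\partial^2\rho}{\partial z_j\partial\bar z_k}(q)\,v_j\bar v_k>0\quad\text{for all } v\in\mathbb C^2\setminus\{0\}\text{ with }\sum_{j=1}^2\frac{\partial\rho}{\partial z_j}(q)\,v_j=0.$$ -/

import Mathlib

/-- `u` is a continuous plurisubharmonic function on `Ω ⊆ ℂⁿ`: it is continuous on `Ω`, and its value
at the center of any closed (affine) complex disc `{a + τ b : |τ| ≤ 1}` contained in `Ω` is at most its
mean over the boundary circle of that disc. -/
def IsContinuousPlurisubharmonicOn {n : ℕ} (u : EuclideanSpace ℂ (Fin n) → ℝ)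
    (Ω : Set (EuclideanSpace ℂ (Fin n))) : Prop :=
  ContinuousOn u Ω ∧
    ∀ a b : EuclideanSpace ℂ (Fin n), (∀ τ : ℂ, ‖τ‖ ≤ 1 → a + τ • b ∈ Ω) →
      u a ≤ Real.circleAverage (fun τ : ℂ => u (a + τ • b)) 0 1

/-- An open set `Ω ⊆ ℂⁿ` is pseudoconvex if it carries a continuous plurisubharmonic exhaustion
function, that is, one all of whose sublevel sets are relatively compact in `Ω`. -/
def IsPseudoconvex {n : ℕ} (Ω : Set (EuclideanSpace ℂ (Fin n))) : Prop :=
  IsOpen Ω ∧ ∃ u : EuclideanSpace ℂ (Fin n) → ℝ, IsContinuousPlurisubharmonicOn u Ω ∧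
    ∀ c : ℝ, ∃ K : Set (EuclideanSpace ℂ (Fin n)), IsCompact K ∧ K ⊆ Ω ∧ {z ∈ Ω | u z < c} ⊆ K

/-- The boundary of `Ω ⊆ ℂⁿ` is `C^{1,1}`-smooth: `Ω = {ρ < 0}` for a continuous `ρ : ℂⁿ → ℝ` with
`∂Ω = {ρ = 0}` such that on some open neighborhood `V` of `∂Ω` the function `ρ` is `C¹` with
Lipschitz derivative, the norm of which is bounded below by a positive constant. -/
def HasC11Boundary {n : ℕ} (Ω : Set (EuclideanSpace ℂ (Fin n))) : Prop :=
  ∃ (ρ : EuclideanSpace ℂ (Fin n) → ℝ) (V : Set (EuclideanSpace ℂ (Fin n))),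
    Continuous ρ ∧ Ω = {z | ρ z < 0} ∧ frontier Ω = {z | ρ z = 0} ∧
    IsOpen V ∧ frontier Ω ⊆ V ∧ ContDiffOn ℝ 1 ρ V ∧
    (∃ K : NNReal, LipschitzOnWith K (fun z => fderiv ℝ ρ z) V) ∧
    ∃ c : ℝ, 0 < c ∧ ∀ z ∈ V, c ≤ ‖fderiv ℝ ρ z‖

/-- The Levi form `∑_{j,k} (∂²ρ/∂z_j∂z̄_k)(p) v_j v̄_k` of a `C²` function `ρ`, written through the real
second derivative as `(D²ρ(p)(v,v) + D²ρ(p)(iv,iv)) / 4`: a quarter of the Laplacian at `τ = 0` of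
`τ ↦ ρ(p + τ v)`. -/
noncomputable def leviForm {n : ℕ} (ρ : EuclideanSpace ℂ (Fin n) → ℝ)
    (p v : EuclideanSpace ℂ (Fin n)) : ℝ :=
  (fderiv ℝ (fderiv ℝ ρ) p v v +
    fderiv ℝ (fderiv ℝ ρ) p (Complex.I • v) (Complex.I • v)) / 4

/-- In a neighborhood `U` of `p`, the boundary of `Ω` is `C²`-smooth and strictly pseudoconvex: there is a
`C²` defining function `ρ` of `Ω` on `U`, with nonvanishing derivative on `∂Ω ∩ U`, whose Levi form is
positive at every `q ∈ ∂Ω ∩ U` on every nonzero complex tangent vector `v`, i.e. one with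
`∑_j (∂ρ/∂z_j)(q) v_j = 0`, which means that `Dρ(q) v = 0` and `Dρ(q) (iv) = 0`. -/
def IsC2StrictlyPseudoconvexNear {n : ℕ} (Ω : Set (EuclideanSpace ℂ (Fin n)))
    (p : EuclideanSpace ℂ (Fin n)) : Prop :=
  ∃ (U : Set (EuclideanSpace ℂ (Fin n))) (ρ : EuclideanSpace ℂ (Fin n) → ℝ),
    IsOpen U ∧ p ∈ U ∧ ContDiffOn ℝ 2 ρ U ∧
    Ω ∩ U = {z ∈ U | ρ z < 0} ∧ frontier Ω ∩ U = {z ∈ U | ρ z = 0} ∧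
    ∀ q ∈ frontier Ω ∩ U, fderiv ℝ ρ q ≠ 0 ∧
      ∀ v : EuclideanSpace ℂ (Fin n), v ≠ 0 → fderiv ℝ ρ q v = 0 →
        fderiv ℝ ρ q (Complex.I • v) = 0 → 0 < leviForm ρ q v

open MeasureTheory Filter Topology Set

/-! Pseudoconvexity is destroyed on a set that pointwise second derivatives on a dense part of the
boundary cannot see. Let `fatSet` be a fat Cantor set K in [-1, 1] filling at least 3/4 of [0, x]
and of [-x, 0] for 0 < x ≤ 1. The profile f with f'' = 2·1_K a.e. and f(0) = f'(0) = 0 is C^{1,1},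
affine near each point off K, yet f(x) ≥ 3x²/4 on [-1, 1]. With z₁ = x + iy, the domain is ρ =
|z|²/2 - f(x) - f(y) - 40 < 0.

Where x, y ∉ K, ρ has the Hessian of |z|²/2, so the boundary is strictly pseudoconvex there
(`leviForm_definingFun`); such boundary points are dense because K is nowhere dense
(`frontier_fatDomain_subset`). But for |z₁| ≤ 1 the profiles outweigh |z₁|²/2: ρ ≤ |z₂|²/2 - |z₁|²/4
- 40 (`definingFun_le_of_norm_le_one`). So discs {|z₁| ≤ 1, z₂ = s} with s increasing to √80 have
rims in a compact part of the domain while their centers reach the boundary, which rules out a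
plurisubharmonic exhaustion. -/

/-! ### The fat Cantor set -/

/-- A ball around the `n`-th point of a dense sequence; its radius is a small multiple of the distance
of the center from `0`. -/
def removedBall (n : ℕ) : Set ℝ :=
  Metric.ball (TopologicalSpace.denseSeq ℝ n) (|TopologicalSpace.denseSeq ℝ n| / 2 ^ (n + 5))

/-- A compact nowhere dense subset of `[-1, 1]` which has large density at `0`. -/
def fatSet : Set ℝ := Icc (-1) 1 \ ⋃ n, removedBall n

theorem isClosed_fatSet : IsClosed fatSet :=
  isClosed_Icc.sdiff (isOpen_iUnion fun _ => Metric.isOpen_ball)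

/-- Every nonzero term of the dense sequence is the center of a nonempty removed ball; the point 0
has radius 0 and is never removed. -/
theorem dense_compl_fatSet : Dense fatSetᶜ := by
  refine ((TopologicalSpace.denseRange_denseSeq ℝ).sdiff_singleton 0).mono ?_
  rintro x ⟨⟨n, rfl⟩, h0⟩ hx
  refine hx.2 (mem_iUnion.2 ⟨n, Metric.mem_ball_self ?_⟩)
  have : 0 < |TopologicalSpace.denseSeq ℝ n| := abs_pos.2 h0
  positivity

/-- The radius is at most |q|/2, so a ball meeting [-x, x] has |q| ≤ 2x, and its length is then a
small multiple of x. The bounds sum to x/4. -/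
theorem volume_removedBall_inter_le {x : ℝ} (n : ℕ) :
    volume (removedBall n ∩ Icc (-x) x) ≤ ENNReal.ofReal (x / 4 * (1 / 2 / 2 ^ n)) := by
  rcases (removedBall n ∩ Icc (-x) x).eq_empty_or_nonempty with h | ⟨y, hy, hyx⟩
  · simp [h]
  · refine (measure_mono inter_subset_left).trans ?_
    rw [removedBall, Real.volume_ball]
    refine ENNReal.ofReal_le_ofReal ?_
    rw [removedBall, Metric.mem_ball, Real.dist_eq] at hy
    set q := TopologicalSpace.denseSeq ℝ n
    have h1 : |q| / 2 ^ (n + 5) ≤ |q| / 2 := by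
      gcongr
      exact le_self_pow₀ (by norm_num) (by omega)
    have h2 : |q| ≤ 2 * x := by
      have := abs_sub_abs_le_abs_sub q y
      rw [abs_sub_comm] at this
      have := abs_le.2 hyx
      linarith
    calc 2 * (|q| / 2 ^ (n + 5)) ≤ 2 * (2 * x / 2 ^ (n + 5)) := by gcongr
      _ = x / 4 * (1 / 2 / 2 ^ n) := by rw [pow_add]; field_simp; ring

theorem volume_iUnion_removedBall_inter_le {x : ℝ} (hx : 0 ≤ x) :
    volume ((⋃ n, removedBall n) ∩ Icc (-x) x) ≤ ENNReal.ofReal (x / 4) := by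
  rw [iUnion_inter]
  refine (measure_iUnion_le _).trans ?_
  refine (ENNReal.tsum_le_tsum volume_removedBall_inter_le).trans ?_
  rw [← ENNReal.ofReal_tsum_of_nonneg (fun n => by positivity)
    ((summable_geometric_two' 1).mul_left _), tsum_mul_left, tsum_geometric_two' 1, mul_one]

/-- Used with J either half of [-x, x]: at most x/4 is removed from the whole interval, hence from
J. -/
theorem le_volume_fatSet_inter {x : ℝ} (hx : 0 ≤ x) (hx1 : x ≤ 1) {J : Set ℝ}
    (hJ : J ⊆ Icc (-x) x) (hvol : volume J = ENNReal.ofReal x) :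
    3 / 4 * x ≤ volume.real (fatSet ∩ J) := by
  have h : J ⊆ (fatSet ∩ J) ∪ ((⋃ n, removedBall n) ∩ Icc (-x) x) := by
    intro y hy
    have hyx := hJ hy
    by_cases hyU : y ∈ ⋃ n, removedBall n
    · exact Or.inr ⟨hyU, hyx⟩
    · exact Or.inl ⟨⟨⟨by linarith [hyx.1], by linarith [hyx.2]⟩, hyU⟩, hy⟩
  have hfin : volume (fatSet ∩ J) ≠ ⊤ :=
    ((measure_mono inter_subset_right).trans_lt (by rw [hvol]; exact ENNReal.ofReal_lt_top)).ne
  have h1 : ENNReal.ofReal x ≤ ENNReal.ofReal (volume.real (fatSet ∩ J) + x / 4) := by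
    rw [ENNReal.ofReal_add measureReal_nonneg (by positivity), measureReal_def,
      ENNReal.ofReal_toReal hfin, ← hvol]
    exact ((measure_mono h).trans (measure_union_le _ _)).trans
      (add_le_add le_rfl (volume_iUnion_removedBall_inter_le hx))
  rw [ENNReal.ofReal_le_ofReal_iff (by positivity)] at h1
  linarith

/-! ### The C^{1,1} profile -/

/-- Twice the indicator function of `fatSet`. -/
noncomputable def fatDensity : ℝ → ℝ := fatSet.indicator fun _ => 2

theorem norm_fatDensity_le (x : ℝ) : ‖fatDensity x‖ ≤ 2 := by
  unfold fatDensity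
  by_cases h : x ∈ fatSet <;> simp [h]

theorem intervalIntegrable_fatDensity (x y : ℝ) : IntervalIntegrable fatDensity volume x y := by
  have hm : Measurable fatDensity := measurable_const.indicator isClosed_fatSet.measurableSet
  exact (intervalIntegrable_const (c := (2 : ℝ))).mono_fun hm.aestronglyMeasurable
    (Eventually.of_forall fun t => by simpa using norm_fatDensity_le t)

/-- The primitive of `fatDensity`. -/
noncomputable def fatSlope (x : ℝ) : ℝ := ∫ t in (0 : ℝ)..x, fatDensity t

theorem fatSlope_sub (x y : ℝ) : fatSlope y - fatSlope x = ∫ t in x..y, fatDensity t :=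
  intervalIntegral.integral_interval_sub_left (intervalIntegrable_fatDensity _ _)
    (intervalIntegrable_fatDensity _ _)

theorem lipschitzWith_fatSlope : LipschitzWith 2 fatSlope := by
  refine LipschitzWith.of_dist_le_mul fun x y => ?_
  rw [Real.dist_eq, fatSlope_sub, Real.dist_eq]
  exact intervalIntegral.norm_integral_le_of_norm_le_const fun t _ => norm_fatDensity_le t

theorem fatSlope_eq_of_uIoc {x y : ℝ} (h : ∀ᵐ t, t ∈ uIoc x y → t ∉ fatSet) :
    fatSlope y = fatSlope x := by
  rw [← sub_eq_zero, fatSlope_sub]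
  refine intervalIntegral.integral_zero_ae (h.mono fun t ht hxy => ?_)
  exact indicator_of_notMem (ht hxy) _

theorem fatSlope_eventuallyEq {x : ℝ} (hx : x ∉ fatSet) :
    ∀ᶠ y in 𝓝 x, fatSlope y = fatSlope x := by
  obtain ⟨r, hr, h⟩ := Metric.isOpen_iff.1 isClosed_fatSet.isOpen_compl x hx
  filter_upwards [Metric.ball_mem_nhds x hr] with y hy
  refine fatSlope_eq_of_uIoc (Eventually.of_forall fun t ht => h ?_)
  exact (convex_ball x r).ordConnected.uIcc_subset (Metric.mem_ball_self hr) hy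
    (uIoc_subset_uIcc ht)

theorem abs_fatSlope_le (x : ℝ) : |fatSlope x| ≤ 2 := by
  have h0 : fatSlope 0 = 0 := by simp [fatSlope]
  have key : ∀ y, |y| ≤ 1 → |fatSlope y| ≤ 2 := fun y hy => by
    have := lipschitzWith_fatSlope.dist_le_mul y 0
    simp only [Real.dist_eq, h0, sub_zero, NNReal.coe_ofNat] at this
    linarith
  rcases le_or_gt |x| 1 with h | h
  · exact key x h
  · rcases lt_abs.1 h with h | h
    · rw [fatSlope_eq_of_uIoc (x := 1) (Eventually.of_forall fun t ht hK => ?_)]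
      · exact key 1 (by simp)
      · rw [uIoc_of_le h.le] at ht
        exact ht.1.not_ge hK.1.2
    · have hx : x ≤ -1 := by linarith
      -- The interval (x, -1] contains its endpoint -1, which may lie in `fatSet`; a single point is
      -- null.
      have hne : ∀ᵐ t : ℝ, t ≠ -1 := by simp [ae_iff]
      rw [← fatSlope_eq_of_uIoc (x := x) (y := -1) (hne.mono fun t hne ht hK => ?_)]
      · exact key (-1) (by simp)
      · rw [uIoc_of_le hx] at ht
        exact hne (le_antisymm ht.2 hK.1.1)

theorem le_fatSlope {x : ℝ} (hx : 0 ≤ x) (hx1 : x ≤ 1) : 3 / 2 * x ≤ fatSlope x := by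
  have h := le_volume_fatSet_inter hx hx1 (J := Ioc 0 x)
    (fun y hy => ⟨by linarith [hy.1], hy.2⟩) (by simp)
  have : fatSlope x = volume.real (fatSet ∩ Ioc 0 x) * 2 := by
    rw [fatSlope, intervalIntegral.integral_of_le hx, fatDensity,
      integral_indicator isClosed_fatSet.measurableSet,
      Measure.restrict_restrict isClosed_fatSet.measurableSet]
    simp
  linarith

theorem fatSlope_le {x : ℝ} (hx : x ≤ 0) (hx1 : -1 ≤ x) : fatSlope x ≤ 3 / 2 * x := by
  have h := le_volume_fatSet_inter (x := -x) (by linarith) (by linarith) (J := Ioc x 0)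
    (fun y hy => ⟨by linarith [hy.1], by linarith [hy.2]⟩) (by simp)
  have : fatSlope x = -(volume.real (fatSet ∩ Ioc x 0) * 2) := by
    rw [fatSlope, intervalIntegral.integral_of_ge hx, fatDensity,
      integral_indicator isClosed_fatSet.measurableSet,
      Measure.restrict_restrict isClosed_fatSet.measurableSet]
    simp
  linarith

/-- A convex function of class `C^{1,1}`, locally affine off `fatSet`, which grows at `0` faster than
`x ^ 2 / 2`. -/
noncomputable def fatProfile (x : ℝ) : ℝ := ∫ t in (0 : ℝ)..x, fatSlope t

@[simp] theorem fatProfile_zero : fatProfile 0 = 0 := by simp [fatProfile]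

theorem hasDerivAt_fatProfile (x : ℝ) : HasDerivAt fatProfile (fatSlope x) x :=
  lipschitzWith_fatSlope.continuous.integral_hasStrictDerivAt 0 x |>.hasDerivAt

theorem abs_fatProfile_sub_le (x y : ℝ) : |fatProfile x - fatProfile y| ≤ 2 * |x - y| := by
  have h := convex_univ.norm_image_sub_le_of_norm_hasDerivWithin_le (f := fatProfile) (C := 2)
    (fun t _ => (hasDerivAt_fatProfile t).hasDerivWithinAt) (fun t _ => abs_fatSlope_le t)
    (mem_univ y) (mem_univ x)
  simpa using h

/-- What matters is that 3/4 exceeds 1/2, so that the two profiles beat |z₁|²/2. -/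
theorem le_fatProfile {x : ℝ} (hx : |x| ≤ 1) : 3 / 4 * x ^ 2 ≤ fatProfile x := by
  have hi : ∀ c d, IntervalIntegrable fatSlope volume c d := fun c d =>
    lipschitzWith_fatSlope.continuous.intervalIntegrable c d
  have hl : ∀ c d, IntervalIntegrable (fun t : ℝ => 3 / 2 * t) volume c d := fun c d =>
    (by fun_prop : Continuous fun t : ℝ => 3 / 2 * t).intervalIntegrable c d
  obtain ⟨h1, h2⟩ := abs_le.1 hx
  rcases le_total 0 x with h | h
  · have := intervalIntegral.integral_mono_on h (hl 0 x) (hi 0 x) fun t ht =>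
      le_fatSlope ht.1 (ht.2.trans h2)
    rw [intervalIntegral.integral_const_mul, integral_id] at this
    change _ ≤ fatProfile x at this
    linarith
  · have := intervalIntegral.integral_mono_on h (hi x 0) (hl x 0) fun t ht =>
      fatSlope_le ht.2 (h1.trans ht.1)
    rw [intervalIntegral.integral_const_mul, integral_id, intervalIntegral.integral_symm] at this
    change -fatProfile x ≤ _ at this
    linarith

theorem fatProfile_eventuallyEq {x : ℝ} (hx : x ∉ fatSet) :
    ∀ᶠ y in 𝓝 x, fatProfile y = fatProfile x + fatSlope x * (y - x) := by
  obtain ⟨r, hr, h⟩ := Metric.eventually_nhds_iff_ball.1 (fatSlope_eventuallyEq hx)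
  filter_upwards [Metric.ball_mem_nhds x hr] with y hy
  have : ∫ t in x..y, fatSlope t = ∫ _ in x..y, fatSlope x :=
    intervalIntegral.integral_congr fun t ht =>
      h t ((convex_ball x r).ordConnected.uIcc_subset (Metric.mem_ball_self hr) hy ht)
  have hi : ∀ c d, IntervalIntegrable fatSlope volume c d := fun c d =>
    lipschitzWith_fatSlope.continuous.intervalIntegrable c d
  rw [← intervalIntegral.integral_interval_sub_left (hi 0 y) (hi 0 x)] at this
  rw [intervalIntegral.integral_const, smul_eq_mul] at this
  simp only [fatProfile]
  linarith

/-! ### The defining function -/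

/-- The real part of the first coordinate. -/
noncomputable def reFst : EuclideanSpace ℂ (Fin 2) →L[ℝ] ℝ :=
  Complex.reCLM ∘L (EuclideanSpace.proj (𝕜 := ℂ) (0 : Fin 2)).restrictScalars ℝ

/-- The imaginary part of the first coordinate. -/
noncomputable def imFst : EuclideanSpace ℂ (Fin 2) →L[ℝ] ℝ :=
  Complex.imCLM ∘L (EuclideanSpace.proj (𝕜 := ℂ) (0 : Fin 2)).restrictScalars ℝ

@[simp] theorem reFst_apply (z : EuclideanSpace ℂ (Fin 2)) : reFst z = (z 0).re := rfl

@[simp] theorem imFst_apply (z : EuclideanSpace ℂ (Fin 2)) : imFst z = (z 0).im := rfl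

theorem abs_reFst_le (z : EuclideanSpace ℂ (Fin 2)) : |reFst z| ≤ ‖z‖ :=
  (Complex.abs_re_le_norm _).trans (PiLp.norm_apply_le z 0)

theorem abs_imFst_le (z : EuclideanSpace ℂ (Fin 2)) : |imFst z| ≤ ‖z‖ :=
  (Complex.abs_im_le_norm _).trans (PiLp.norm_apply_le z 0)

/-- The defining function of the domain. -/
noncomputable def definingFun (z : EuclideanSpace ℂ (Fin 2)) : ℝ :=
  ‖z‖ ^ 2 / 2 - fatProfile (reFst z) - fatProfile (imFst z) - 40

/-- The derivative of `definingFun`. -/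
noncomputable def definingFunDeriv (z : EuclideanSpace ℂ (Fin 2)) :
    EuclideanSpace ℂ (Fin 2) →L[ℝ] ℝ :=
  innerSL ℝ z - fatSlope (reFst z) • reFst - fatSlope (imFst z) • imFst

theorem hasFDerivAt_definingFun (z : EuclideanSpace ℂ (Fin 2)) :
    HasFDerivAt definingFun (definingFunDeriv z) z := by
  have h1 := (hasStrictFDerivAt_norm_sq z).hasFDerivAt.const_mul (1 / 2 : ℝ)
  have h2 := (hasDerivAt_fatProfile (reFst z)).comp_hasFDerivAt z reFst.hasFDerivAt
  have h3 := (hasDerivAt_fatProfile (imFst z)).comp_hasFDerivAt z imFst.hasFDerivAt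
  refine (((h1.sub h2).sub h3).sub_const 40).congr_fderiv ?_ |>.congr_of_eventuallyEq ?_
  · ext v
    simp [definingFunDeriv]
  · exact Eventually.of_forall fun y => by simp [definingFun]; ring

theorem fderiv_definingFun : fderiv ℝ definingFun = definingFunDeriv :=
  funext fun z => (hasFDerivAt_definingFun z).fderiv

theorem lipschitzWith_definingFunDeriv :
    ∃ K, LipschitzWith K definingFunDeriv := by
  have h1 := (innerSL ℝ (E := EuclideanSpace ℂ (Fin 2))).lipschitz
  have h2 := ((ContinuousLinearMap.toSpanSingleton ℝ reFst).lipschitz.comp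
    lipschitzWith_fatSlope).comp reFst.lipschitz
  have h3 := ((ContinuousLinearMap.toSpanSingleton ℝ imFst).lipschitz.comp
    lipschitzWith_fatSlope).comp imFst.lipschitz
  exact ⟨_, (h1.sub h2).sub h3⟩

theorem contDiff_definingFun : ContDiff ℝ 1 definingFun := by
  refine contDiff_one_iff_fderiv.2 ⟨fun z => (hasFDerivAt_definingFun z).differentiableAt, ?_⟩
  rw [fderiv_definingFun]
  exact lipschitzWith_definingFunDeriv.choose_spec.continuous

theorem continuous_definingFun : Continuous definingFun := contDiff_definingFun.continuous

theorem abs_fatProfile_le (x : ℝ) : |fatProfile x| ≤ 2 * |x| := by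
  simpa using abs_fatProfile_sub_le x 0

/-- The two profiles together are at most 4‖z‖ in size, and 25/2 + 20 < 40. -/
theorem definingFun_neg_of_norm_le {z : EuclideanSpace ℂ (Fin 2)} (hz : ‖z‖ ≤ 5) :
    definingFun z < 0 := by
  have h1 := (neg_abs_le _).trans' (neg_le_neg (abs_fatProfile_le (reFst z)))
  have h2 := (neg_abs_le _).trans' (neg_le_neg (abs_fatProfile_le (imFst z)))
  have h3 := abs_reFst_le z
  have h4 := abs_imFst_le z
  unfold definingFun
  nlinarith [norm_nonneg z]

theorem norm_lt_of_definingFun_neg {z : EuclideanSpace ℂ (Fin 2)} (hz : definingFun z < 0) :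
    ‖z‖ < 20 := by
  have h1 := (le_abs_self _).trans (abs_fatProfile_le (reFst z))
  have h2 := (le_abs_self _).trans (abs_fatProfile_le (imFst z))
  have h3 := abs_reFst_le z
  have h4 := abs_imFst_le z
  unfold definingFun at hz
  by_contra! h
  nlinarith

/-- The defining function increases strictly along rays far from the origin. -/
theorem definingFun_smul_neg {z : EuclideanSpace ℂ (Fin 2)} (hz : definingFun z ≤ 0) {t : ℝ}
    (h0 : 0 ≤ t) (h1 : t < 1) : definingFun (t • z) < 0 := by
  by_cases h5 : ‖t • z‖ ≤ 5
  · exact definingFun_neg_of_norm_le h5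
  have key : ∀ x : ℝ, |x| ≤ ‖z‖ →
      fatProfile x - fatProfile (t * x) ≤ 2 * ((1 - t) * ‖z‖) := fun x hx => by
    refine (le_abs_self _).trans ((abs_fatProfile_sub_le _ _).trans ?_)
    rw [show x - t * x = (1 - t) * x by ring, abs_mul, abs_of_pos (by linarith : 0 < 1 - t)]
    gcongr
  have k1 := key _ (abs_reFst_le z)
  have k2 := key _ (abs_imFst_le z)
  rw [norm_smul, Real.norm_of_nonneg h0, not_le] at h5
  have hz5 : 5 < ‖z‖ := by nlinarith [norm_nonneg z]
  unfold definingFun at hz ⊢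
  rw [map_smul, map_smul, norm_smul, Real.norm_of_nonneg h0, smul_eq_mul, smul_eq_mul]
  have : 0 < (1 - t) * ‖z‖ * ((‖z‖ + t * ‖z‖) / 2 - 4) := by
    have : 0 < 1 - t := by linarith
    have : 0 < (‖z‖ + t * ‖z‖) / 2 - 4 := by linarith
    positivity
  nlinarith

/-! ### The domain and its C^{1,1} boundary -/

/-- The domain. -/
def fatDomain : Set (EuclideanSpace ℂ (Fin 2)) := {z | definingFun z < 0}

theorem isOpen_fatDomain : IsOpen fatDomain := isOpen_lt continuous_definingFun continuous_const

theorem isConnected_fatDomain : IsConnected fatDomain := by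
  have h0 : (0 : EuclideanSpace ℂ (Fin 2)) ∈ fatDomain :=
    definingFun_neg_of_norm_le (by simp)
  have hstar : StarConvex ℝ 0 fatDomain := by
    refine starConvex_zero_iff.2 fun z hz t ht0 ht1 => ?_
    rcases ht1.eq_or_lt with rfl | ht1
    · simpa using hz
    · exact definingFun_smul_neg (le_of_lt hz) ht0 ht1
  exact (hstar.isPathConnected h0).isConnected

theorem isBounded_fatDomain : Bornology.IsBounded fatDomain :=
  Metric.isBounded_ball.subset fun _ hz =>
    mem_ball_zero_iff.2 (norm_lt_of_definingFun_neg hz)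

/-- A zero z of the defining function is the limit of the interior points tz as t increases to 1. -/
theorem frontier_fatDomain : frontier fatDomain = {z | definingFun z = 0} := by
  refine (frontier_lt_subset_eq continuous_definingFun continuous_const).antisymm fun z hz => ?_
  change definingFun z = 0 at hz
  change z ∈ frontier fatDomain
  rw [isOpen_fatDomain.frontier_eq]
  refine ⟨?_, fun h => (ne_of_lt h) hz⟩
  have hlim : Tendsto (fun t : ℝ => t • z) (𝓝[<] 1) (𝓝 z) := by
    have : Continuous fun t : ℝ => t • z := by fun_prop
    simpa using (this.tendsto 1).mono_left nhdsWithin_le_nhds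
  refine mem_closure_of_tendsto hlim ?_
  filter_upwards [Ioo_mem_nhdsLT (zero_lt_one' ℝ)] with t ht
  exact definingFun_smul_neg hz.le ht.1.le ht.2

theorem five_lt_norm_of_mem_frontier {z : EuclideanSpace ℂ (Fin 2)}
    (hz : z ∈ frontier fatDomain) : 5 < ‖z‖ := by
  rw [frontier_fatDomain] at hz
  by_contra h
  exact (definingFun_neg_of_norm_le (not_lt.1 h)).ne hz

/-- The radial derivative Dρ(z)z is at least ‖z‖² - 4‖z‖, so ‖Dρ(z)‖ ≥ ‖z‖ - 4. -/
theorem one_le_norm_definingFunDeriv {z : EuclideanSpace ℂ (Fin 2)} (hz : 5 < ‖z‖) :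
    1 ≤ ‖definingFunDeriv z‖ := by
  have key : ∀ x : ℝ, |x| ≤ ‖z‖ → fatSlope x * x ≤ 2 * ‖z‖ := fun x hx =>
    (le_abs_self _).trans <| by
      rw [abs_mul]
      exact mul_le_mul (abs_fatSlope_le x) hx (abs_nonneg _) zero_le_two
  have k1 := key _ (abs_reFst_le z)
  have k2 := key _ (abs_imFst_le z)
  have h1 : definingFunDeriv z z =
      ‖z‖ ^ 2 - fatSlope (reFst z) * reFst z - fatSlope (imFst z) * imFst z := by
    simp [definingFunDeriv]
  have h2 := (le_abs_self _).trans ((definingFunDeriv z).le_opNorm z)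
  rw [h1] at h2
  by_contra! h
  nlinarith

theorem hasC11Boundary_fatDomain : HasC11Boundary fatDomain := by
  refine ⟨definingFun, {z | 5 < ‖z‖}, continuous_definingFun, rfl, frontier_fatDomain,
    isOpen_lt continuous_const continuous_norm, fun z hz =>
    five_lt_norm_of_mem_frontier hz, contDiff_definingFun.contDiffOn,
    ?_, 1, one_pos, fun z hz => ?_⟩
  · obtain ⟨K, hK⟩ := lipschitzWith_definingFunDeriv
    exact ⟨K, by rw [fderiv_definingFun]; exact hK.lipschitzOnWith⟩
  · change 5 < ‖z‖ at hz
    rw [fderiv_definingFun]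
    exact one_le_norm_definingFunDeriv hz

/-! ### The exceptional set and strict pseudoconvexity off it -/

/-- The boundary points whose first coordinate has its real or imaginary part in `fatSet`. -/
def fatBoundary : Set (EuclideanSpace ℂ (Fin 2)) :=
  frontier fatDomain ∩ (reFst ⁻¹' fatSet ∪ imFst ⁻¹' fatSet)

theorem isClosed_fatBoundary : IsClosed fatBoundary :=
  isClosed_frontier.inter ((isClosed_fatSet.preimage reFst.continuous).union
    (isClosed_fatSet.preimage imFst.continuous))

theorem contDiffAt_fatProfile {x : ℝ} (hx : x ∉ fatSet) : ContDiffAt ℝ 2 fatProfile x :=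
  (by fun_prop : ContDiffAt ℝ 2 (fun y => fatProfile x + fatSlope x * (y - x)) x)
    |>.congr_of_eventuallyEq (fatProfile_eventuallyEq hx)

theorem contDiffAt_definingFun {z : EuclideanSpace ℂ (Fin 2)} (h1 : reFst z ∉ fatSet)
    (h2 : imFst z ∉ fatSet) : ContDiffAt ℝ 2 definingFun z := by
  have k1 : ContDiffAt ℝ 2 (fun y => fatProfile (reFst y)) z :=
    (contDiffAt_fatProfile h1).comp z reFst.contDiff.contDiffAt
  have k2 : ContDiffAt ℝ 2 (fun y => fatProfile (imFst y)) z :=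
    (contDiffAt_fatProfile h2).comp z imFst.contDiff.contDiffAt
  exact (((((contDiff_norm_sq ℝ).contDiffAt).div_const 2).sub k1).sub k2).sub contDiffAt_const

theorem fderiv_definingFunDeriv {z : EuclideanSpace ℂ (Fin 2)} (h1 : reFst z ∉ fatSet)
    (h2 : imFst z ∉ fatSet) : fderiv ℝ definingFunDeriv z = innerSL ℝ := by
  have h : definingFunDeriv =ᶠ[𝓝 z] fun y =>
      innerSL ℝ y - fatSlope (reFst z) • reFst - fatSlope (imFst z) • imFst := by
    filter_upwards [reFst.continuous.continuousAt.eventually (fatSlope_eventuallyEq h1),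
      imFst.continuous.continuousAt.eventually (fatSlope_eventuallyEq h2)] with y hy1 hy2
    rw [definingFunDeriv, hy1, hy2]
  rw [h.fderiv_eq]
  exact (((innerSL ℝ).hasFDerivAt.sub_const _).sub_const _).fderiv

theorem leviForm_definingFun {z : EuclideanSpace ℂ (Fin 2)} (h1 : reFst z ∉ fatSet)
    (h2 : imFst z ∉ fatSet) (v : EuclideanSpace ℂ (Fin 2)) :
    leviForm definingFun z v = ‖v‖ ^ 2 / 2 := by
  rw [leviForm, fderiv_definingFun, fderiv_definingFunDeriv h1 h2, innerSL_apply_apply,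
    innerSL_apply_apply, real_inner_self_eq_norm_sq, real_inner_self_eq_norm_sq, norm_smul,
    Complex.norm_I]
  ring

theorem isC2StrictlyPseudoconvexNear_fatDomain {p : EuclideanSpace ℂ (Fin 2)}
    (hp : p ∈ frontier fatDomain \ fatBoundary) : IsC2StrictlyPseudoconvexNear fatDomain p := by
  obtain ⟨hp, hpE⟩ := hp
  have hp' : p ∈ (reFst ⁻¹' fatSet ∪ imFst ⁻¹' fatSet)ᶜ := fun h => hpE ⟨hp, h⟩
  refine ⟨(reFst ⁻¹' fatSet ∪ imFst ⁻¹' fatSet)ᶜ, definingFun,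
    ((isClosed_fatSet.preimage reFst.continuous).union
    (isClosed_fatSet.preimage imFst.continuous)).isOpen_compl, hp', fun z hz => ?_, ?_, ?_,
    fun q hq => ⟨?_, fun v hv _ _ => ?_⟩⟩
  · exact (contDiffAt_definingFun (fun h => hz (Or.inl h))
      (fun h => hz (Or.inr h))).contDiffWithinAt
  · rw [inter_comm]; rfl
  · rw [inter_comm, frontier_fatDomain]; rfl
  · have := one_le_norm_definingFunDeriv (five_lt_norm_of_mem_frontier hq.1)
    rw [fderiv_definingFun]
    exact norm_pos_iff.1 (by linarith)
  · rw [leviForm_definingFun (fun h => hq.2 (Or.inl h)) (fun h => hq.2 (Or.inr h))]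
    have := norm_pos_iff.2 hv
    positivity

/-! ### Density of the strictly pseudoconvex points -/

/-- Since ρ = g(z₁) + |z₂|²/2, the boundary is |z₂| = √(-2g(z₁)) over {g ≤ 0}. The first coordinate
is approximated in {g < 0} by points with both parts off `fatSet`, and the approximation is lifted
with the phase of z₂ fixed. -/
theorem frontier_fatDomain_subset :
    frontier fatDomain ⊆ closure (frontier fatDomain \ fatBoundary) := by
  intro p hp
  let ι : ℂ → EuclideanSpace ℂ (Fin 2) := fun ζ => !₂[ζ, 0]
  have hι : Continuous ι := by fun_prop
  let g : ℂ → ℝ := fun ζ => definingFun (ι ζ)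
  have hg : Continuous g := continuous_definingFun.comp hι
  have hdef : ∀ z, definingFun z = g (z 0) + ‖z 1‖ ^ 2 / 2 := fun z => by
    simp only [g, definingFun, EuclideanSpace.norm_sq_eq, Fin.sum_univ_two, reFst_apply,
      imFst_apply, ι]
    simp
    ring
  have hdense : Dense (fatSetᶜ ×ℂ fatSetᶜ) := by
    have := (dense_compl_fatSet.prod dense_compl_fatSet).preimage
      Complex.equivRealProdCLM.toHomeomorph.isOpenMap
    exact this
  have hp0 : p 0 ∈ closure {ζ | g ζ < 0} := by
    have h0 : Continuous fun z : EuclideanSpace ℂ (Fin 2) => z 0 := by fun_prop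
    refine map_mem_closure (f := fun z : EuclideanSpace ℂ (Fin 2) => z 0) h0
      (frontier_subset_closure hp) fun z hz => ?_
    change definingFun z < 0 at hz
    rw [hdef] at hz
    change g _ < 0
    nlinarith [sq_nonneg ‖z 1‖]
  have hp1 : p 0 ∈ closure ({ζ | g ζ < 0} ∩ (fatSetᶜ ×ℂ fatSetᶜ)) := by
    exact closure_minimal (hdense.open_subset_closure_inter (isOpen_lt hg continuous_const))
      isClosed_closure hp0
  let ω : ℂ := Complex.exp ((p 1).arg * Complex.I)
  have hω : ‖ω‖ = 1 := Complex.norm_exp_ofReal_mul_I _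
  -- `Real.sqrt` vanishes on negative reals, so `S` is continuous on all of ℂ, including where g >
  -- 0.
  let S : ℂ → EuclideanSpace ℂ (Fin 2) := fun ζ => !₂[ζ, (Real.sqrt (-(2 * g ζ)) : ℂ) * ω]
  have hS : Continuous S := by fun_prop
  have hSp : S (p 0) = p := by
    rw [frontier_fatDomain] at hp
    have h : -(2 * g (p 0)) = ‖p 1‖ ^ 2 := by
      have := (hdef p).symm.trans hp
      linarith
    ext i
    fin_cases i
    · rfl
    · simp [S, h, ω, Complex.norm_mul_exp_arg_mul_I]
  rw [← hSp]
  refine map_mem_closure hS hp1 fun ζ hζ => ⟨?_, fun hE => ?_⟩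
  · rw [frontier_fatDomain]
    have hneg : 0 ≤ -(2 * g ζ) := by linarith [show g ζ < 0 from hζ.1]
    change definingFun (S ζ) = 0
    rw [hdef]
    have h1 : S ζ 1 = (Real.sqrt (-(2 * g ζ)) : ℂ) * ω := rfl
    have h0 : S ζ 0 = ζ := rfl
    rw [h0, h1, norm_mul, hω, mul_one, Complex.norm_real, Real.norm_of_nonneg (Real.sqrt_nonneg _),
      Real.sq_sqrt hneg]
    ring
  · rcases hE.2 with h | h
    · exact hζ.2.1 h
    · exact hζ.2.2 h

/-! ### Failure of pseudoconvexity -/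

theorem definingFun_le_of_norm_le_one {ζ w : ℂ} (hζ : ‖ζ‖ ≤ 1) :
    definingFun !₂[ζ, w] ≤ ‖w‖ ^ 2 / 2 - ‖ζ‖ ^ 2 / 4 - 40 := by
  have h1 := le_fatProfile ((Complex.abs_re_le_norm ζ).trans hζ)
  have h2 := le_fatProfile ((Complex.abs_im_le_norm ζ).trans hζ)
  have h3 : ‖ζ‖ ^ 2 = ζ.re ^ 2 + ζ.im ^ 2 := by
    rw [← Complex.normSq_eq_norm_sq, Complex.normSq_apply]; ring
  simp only [definingFun, EuclideanSpace.norm_sq_eq, Fin.sum_univ_two, reFst_apply, imFst_apply]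
  simp
  linarith

/-- Continuity principle: u is bounded on the compact union of the rims, hence at the disc centers
by the mean value inequality. The centers thus stay in a compact subset of the domain, yet converge
to a boundary point. -/
theorem not_isPseudoconvex_fatDomain : ¬ IsPseudoconvex fatDomain := by
  rintro ⟨-, u, ⟨huc, hu⟩, hex⟩
  let D : ℂ × ℝ → EuclideanSpace ℂ (Fin 2) := fun q => !₂[q.1, (q.2 : ℂ)]
  have hD : Continuous D := by fun_prop
  have hle : ∀ ζ : ℂ, ∀ s : ℝ, ‖ζ‖ ≤ 1 →
      definingFun (D (ζ, s)) ≤ s ^ 2 / 2 - ‖ζ‖ ^ 2 / 4 - 40 := fun ζ s hζ => by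
    simpa using definingFun_le_of_norm_le_one (w := (s : ℂ)) hζ
  have h80 : Real.sqrt 80 ^ 2 = 80 := Real.sq_sqrt (by norm_num)
  have hsq : ∀ s ∈ Icc 0 (Real.sqrt 80), s ^ 2 ≤ 80 := fun s hs => by
    rw [← h80]; gcongr; exacts [hs.1, hs.2]
  -- The value s = √80 is included: the rim of the limit disc still has ρ ≤ -1/4, while its center
  -- has ρ = 0.
  have hT : IsCompact (Metric.sphere (0 : ℂ) 1 ×ˢ Icc 0 (Real.sqrt 80)) :=
    (isCompact_sphere 0 1).prod isCompact_Icc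
  have hTΩ : MapsTo D (Metric.sphere (0 : ℂ) 1 ×ˢ Icc 0 (Real.sqrt 80)) fatDomain := by
    rintro ⟨ζ, s⟩ ⟨hζ, hs⟩
    have hζ : ‖ζ‖ = 1 := by simpa using hζ
    have := hle ζ s hζ.le
    rw [hζ] at this
    change definingFun _ < 0
    linarith [hsq s hs]
  obtain ⟨M, hM⟩ := (hT.image_of_continuousOn (huc.comp hD.continuousOn hTΩ)).bddAbove
  obtain ⟨K, hK, hKΩ, hKu⟩ := hex (M + 1)
  have hmem : ∀ s ∈ Ico 0 (Real.sqrt 80), D (0, s) ∈ K := fun s hs => by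
    have hs2 : s ^ 2 < 80 := by rw [← h80]; gcongr; exacts [hs.1, hs.2]
    have hline : ∀ τ : ℂ, D (0, s) + τ • D (1, 0) = D (τ, s) := fun τ => by
      ext i; fin_cases i <;> simp [D]
    have hdisc : ∀ τ : ℂ, ‖τ‖ ≤ 1 → D (τ, s) ∈ fatDomain := fun τ hτ => by
      have := hle τ s hτ
      change definingFun _ < 0
      nlinarith [sq_nonneg ‖τ‖]
    have hsM : u (D (0, s)) ≤ M := by
      refine (hu (D (0, s)) (D (1, 0)) fun τ hτ => by rw [hline]; exact hdisc τ hτ).trans ?_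
      simp only [hline]
      refine Real.circleAverage_mono_on_of_le_circle ?_ fun τ hτ => ?_
      · refine ContinuousOn.circleIntegrable zero_le_one ?_
        exact huc.comp (by fun_prop) fun τ hτ => hdisc τ (mem_sphere_zero_iff_norm.1 hτ).le
      · rw [abs_one] at hτ
        exact hM ⟨(τ, s), ⟨hτ, hs.1, hs.2.le⟩, rfl⟩
    exact hKu ⟨by simpa using hdisc 0 (by simp), by linarith⟩
  have hlim : D (0, Real.sqrt 80) ∈ K := by
    refine hK.isClosed.mem_of_tendsto (b := 𝓝[<] Real.sqrt 80) (f := fun s => D (0, s)) ?_ ?_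
    · exact ((by fun_prop : Continuous fun s => D (0, s)).tendsto _).mono_left nhdsWithin_le_nhds
    · filter_upwards [Ioo_mem_nhdsLT (show 0 < Real.sqrt 80 by positivity)] with s hs
      exact hmem s ⟨hs.1.le, hs.2⟩
  have h0 : definingFun (D (0, Real.sqrt 80)) < 0 := hKΩ hlim
  simp [D, definingFun, EuclideanSpace.norm_sq_eq] at h0
  norm_num at h0

theorem proposition1p2 :
    ∃ Ω E : Set (EuclideanSpace ℂ (Fin 2)),
      IsOpen Ω ∧ IsConnected Ω ∧ Bornology.IsBounded Ω ∧
      HasC11Boundary Ω ∧ ¬ IsPseudoconvex Ω ∧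
      IsClosed E ∧ E ⊆ frontier Ω ∧ frontier Ω ⊆ closure (frontier Ω \ E) ∧
      ∀ p ∈ frontier Ω \ E, IsC2StrictlyPseudoconvexNear Ω p :=
  ⟨fatDomain, fatBoundary, isOpen_fatDomain, isConnected_fatDomain, isBounded_fatDomain,
    hasC11Boundary_fatDomain, not_isPseudoconvex_fatDomain, isClosed_fatBoundary,
    inter_subset_left, frontier_fatDomain_subset, fun _ => isC2StrictlyPseudoconvexNear_fatDomain⟩
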